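/- Let $\mathcal X=\{0,1\}$, let $\mathcal Y,\mathcal Z$ be finite alphabets, and let $W_{Y|X}$ (to the receiver) and $W_{Z|X}$ (to the warden) be discrete memoryless channels with input alphabet $\mathcal X$. Write $P_x=W_{Y|X=x}$ and $Q_x=W_{Z|X=x}$, and assume $Q_0\neq Q_1$, $Q_1\ll Q_0$ and $P_1\ll P_0$. Let $\mathsf q:\mathcal X\times\mathcal Y\to(0,\infty)$ be a decoding metric, $\mathsf q^n(\mathbf x,\mathbf y)=\prod_{i=1}^n\mathsf q(x_i,y_i)$, and let $\delta>0$. Logarithms are natural, and $\mathbb D(P\Vert Q)=\sum_a P(a)\log\frac{P(a)}{Q(a)}$, which is $+\infty$ unless $P\ll Q$. A code $\mathcal C$ of blocklength $n$ consists of nonempty finite sets $\mathcal M$ (messages) and $\mathcal K$ (shared keys) and codewords $\mathbf x(m,k)\in\mathcal X^n$ for $(m,k)\in\mathcal M\times\mathcal K$. Its maximal probability of error is $$P^{\max}_{\rm err}(\mathcal C)=\max_{m,k}\ \mathbb P_{\mathbf Y\sim W_{Y|X}^{\otimes n}(\cdot|\mathbf x(m,k))}\big(\exists\, m'\neq m:\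 \mathsf q^n(\mathbf x(m',k),\mathbf Y)\ge \mathsf q^n(\mathbf x(m,k),\mathbf Y)\big),$$ and its output distribution at the warden is $\widehat Q^n_{\mathcal C}(\mathbf z)=\frac1{|\mathcal M||\mathcal K|}\sum_{m,k}W_{Z|X}^{\otimes n}(\mathbf z|\mathbf x(m,k))$. A rate pair $(R,R_K)$ is $(\mathsf q,\delta)$-achievable if there is a sequence of codes of increasing blocklengths $n$ along which $$\liminf\frac{\log|\mathcal M|}{\sqrt n}\ge R,\qquad \limsup\frac{\log|\mathcal K|}{\sqrt n}\le R_K,\qquad \lim\mathbb D\big(\widehat Q^n_{\mathcal C}\Vert Q_0^{\otimes n}\big)\le\delta,\qquad \lim P^{\max}_{\rm err}(\mathcal C)=0 .$$ The covert mismatch capacity $\mathsf C_{\mathsf q,\delta}$ is the supremum of $R$ over all $(\mathsf q,\delta)$-achievable rate pairs. Put $t_\delta=\sqrt{2\delta/\chi_2(Q_1\Vert Q_0)}$ with $\chi_2(Q_1\Vert Q_0)=\sum_z\frac{(Q_1(z)-Q_0(z))^2}{Q_0(z)}$, where the sum is over the $z$ with $Q_0(z)>0$. For $y,\hat y\in\mathcal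 Y$ let $\mathcal S_{\mathsf q}(y,\hat y)\subseteq\mathcal X$ be the set of all maximizers of $x\mapsto \mathsf q(x,\hat y)/\mathsf q(x,y)$. Let $\mathcal M_{\max}(\mathsf q)$ be the set of conditional distributions $P_{Y\widehat Y|X}$ on $\mathcal Y\times\mathcal Y$ given $\mathcal X$ such that $P_{Y\widehat Y|X}(y,\hat y|x)=0$ for all $y,\hat y$ and all $x\notin\mathcal S_{\mathsf q}(y,\hat y)$. **Theorem.** The minimum below exists and is finite, and $$\mathsf C_{\mathsf q,\delta}\ \le\ t_\delta\cdot\min_{P_{Y\widehat Y|X}\in\mathcal M_{\max}(\mathsf q):\ P_{Y|X}=W_{Y|X}}\ \mathbb D\big(P_{\widehat Y|X=1}\,\Vert\,P_{\widehat Y|X=0}\big).$$ -/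

import Mathlib

open Filter Topology

noncomputable section

/-! Input alphabet `Fin 2`, with innocent symbol `0`; output alphabets are finite types.
A channel is `W : Fin 2 → Y → ℝ`, where `W x y` is the probability of output `y` given input `x`. -/

/-- `W` is a conditional probability distribution on `Y` given the binary input:
each `W x` is a probability vector. -/
def IsChannel {Y : Type*} [Fintype Y] (W : Fin 2 → Y → ℝ) : Prop :=
  ∀ x, W x ∈ stdSimplex ℝ Y

/-- Absolute continuity `P ≪ Q` of distributions on a finite alphabet. -/
def AbsCont {A : Type*} (P Q : A → ℝ) : Prop :=
  ∀ a, Q a = 0 → P a = 0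

open Classical in
/-- Kullback-Leibler divergence (natural logarithm) of distributions on a finite alphabet;
it is `⊤` if `P` is not absolutely continuous with respect to `Q`.
Terms with `P a = 0` contribute `0`. -/
def klDist {A : Type*} [Fintype A] (P Q : A → ℝ) : EReal :=
  if AbsCont P Q then ((∑ a, P a * Real.log (P a / Q a) : ℝ) : EReal) else ⊤

/-- The chi-squared distance `χ₂(P ‖ Q)`; it is used for `P ≪ Q` only, where the terms with
`Q a = 0` are `0 / 0 = 0`. -/
def chiSq {A : Type*} [Fintype A] (P Q : A → ℝ) : ℝ :=
  ∑ a, (P a - Q a) ^ 2 / Q a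

/-- The `n`-fold product distribution of `P`. -/
def prodDist {A : Type*} (n : ℕ) (P : A → ℝ) (a : Fin n → A) : ℝ :=
  ∏ i, P (a i)

/-- The memoryless extension of the channel `W` to `n` uses: probability of `y` given `x`. -/
def chanPow {Y : Type*} {n : ℕ} (W : Fin 2 → Y → ℝ) (x : Fin n → Fin 2) (y : Fin n → Y) : ℝ :=
  ∏ i, W (x i) (y i)

/-- The multiplicative extension of the decoding metric to sequences. -/
def metricPow {Y : Type*} {n : ℕ} (q : Fin 2 → Y → ℝ) (x : Fin n → Fin 2) (y : Fin n → Y) : ℝ :=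
  ∏ i, q (x i) (y i)

/-- A code of blocklength `n`: nonempty finite sets of messages and of shared keys, and a codeword
for each message-key pair. -/
structure Code (n : ℕ) where
  numMsg : ℕ
  numKey : ℕ
  numMsg_pos : 0 < numMsg
  numKey_pos : 0 < numKey
  codeword : Fin numMsg → Fin numKey → Fin n → Fin 2

namespace Code

variable {n : ℕ} {Y Z : Type*} [Fintype Y] [Fintype Z]

open Classical in
/-- Probability of decoding error for the message-key pair `(m, k)`: the probability, when
`x(m, k)` is sent, of the outputs for which some other message has a metric at least as large
(a tie is an error). -/
def errProb (C : Code n) (W q : Fin 2 → Y → ℝ) (m : Fin C.numMsg) (k : Fin C.numKey) : ℝ :=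
  ∑ y : Fin n → Y,
    if ∃ m', m' ≠ m ∧ metricPow q (C.codeword m k) y ≤ metricPow q (C.codeword m' k) y
    then chanPow W (C.codeword m k) y else 0

/-- Maximal probability of error, over all message-key pairs. -/
def maxErrProb (C : Code n) (W q : Fin 2 → Y → ℝ) : ℝ :=
  ⨆ p : Fin C.numMsg × Fin C.numKey, C.errProb W q p.1 p.2

/-- Output distribution at the warden, for uniform message and key. -/
def wardenDist (C : Code n) (V : Fin 2 → Z → ℝ) (z : Fin n → Z) : ℝ :=
  1 / ((C.numMsg : ℝ) * (C.numKey : ℝ)) * ∑ m, ∑ k, chanPow V (C.codeword m k) z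

end Code

/-- The rate pair `(R, RK)` is `(q, δ)`-achievable for the receiver's channel `W` and the warden's
channel `V`: there is a sequence of codes `C j` of increasing blocklengths `n j` with
`liminf log |M| / √n ≥ R`, `limsup log |K| / √n ≤ RK`, with a divergence at the warden that has a
limit, at most `δ`, and with vanishing maximal probability of error. -/
def IsAchievable {Y Z : Type*} [Fintype Y] [Fintype Z] (W : Fin 2 → Y → ℝ) (V : Fin 2 → Z → ℝ)
    (q : Fin 2 → Y → ℝ) (δ R RK : ℝ) : Prop :=
  ∃ (n : ℕ → ℕ) (C : ∀ j, Code (n j)), StrictMono n ∧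
    (R : EReal) ≤
      liminf (fun j => ((Real.log ((C j).numMsg : ℝ) / √(n j : ℝ) : ℝ) : EReal)) atTop ∧
    limsup (fun j => ((Real.log ((C j).numKey : ℝ) / √(n j : ℝ) : ℝ) : EReal)) atTop ≤
      (RK : EReal) ∧
    (∃ d : EReal, d ≤ (δ : EReal) ∧
      Tendsto (fun j => klDist ((C j).wardenDist V) (prodDist (n j) (V 0))) atTop (𝓝 d)) ∧
    Tendsto (fun j => (C j).maxErrProb W q) atTop (𝓝 0)

/-- The covert mismatch capacity: the supremum of `R` over all achievable rate pairs, taken in the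
extended reals. -/
def covertMismatchCapacity {Y Z : Type*} [Fintype Y] [Fintype Z] (W : Fin 2 → Y → ℝ)
    (V : Fin 2 → Z → ℝ) (q : Fin 2 → Y → ℝ) (δ : ℝ) : EReal :=
  sSup {r : EReal | ∃ R RK : ℝ, r = (R : EReal) ∧ IsAchievable W V q δ R RK}

/-- The weight parameter `t_δ = √(2 δ / χ₂(Q₁ ‖ Q₀))` of the warden's channel. -/
def weightParam {Z : Type*} [Fintype Z] (V : Fin 2 → Z → ℝ) (δ : ℝ) : ℝ :=
  √(2 * δ / chiSq (V 1) (V 0))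

/-- The set of all maximizers `x` of `q(x, ŷ) / q(x, y)`. -/
def maximizers {Y : Type*} (q : Fin 2 → Y → ℝ) (y yh : Y) : Set (Fin 2) :=
  {x | ∀ x', q x' yh / q x' y ≤ q x yh / q x y}

/-- `P x (y, ŷ)` is a maximal joint conditional distribution. -/
def IsMaximalJoint {Y : Type*} [Fintype Y] (q : Fin 2 → Y → ℝ) (P : Fin 2 → Y × Y → ℝ) : Prop :=
  (∀ x, P x ∈ stdSimplex ℝ (Y × Y)) ∧
    ∀ y yh x, x ∉ maximizers q y yh → P x (y, yh) = 0

/-- First marginal (of `Y` given `X = x`). -/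
def margFst {Y : Type*} [Fintype Y] (P : Fin 2 → Y × Y → ℝ) (x : Fin 2) (y : Y) : ℝ :=
  ∑ yh, P x (y, yh)

/-- Second marginal (of `Ŷ` given `X = x`). -/
def margSnd {Y : Type*} [Fintype Y] (P : Fin 2 → Y × Y → ℝ) (x : Fin 2) (yh : Y) : ℝ :=
  ∑ y, P x (y, yh)

/-- The values of `D(P_{Ŷ|X=1} ‖ P_{Ŷ|X=0})` over the maximal joint conditional distributions `P`
whose first marginal is the channel `W`. -/
def maximalDivergences {Y : Type*} [Fintype Y] (W q : Fin 2 → Y → ℝ) : Set EReal :=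
  {D | ∃ P : Fin 2 → Y × Y → ℝ, IsMaximalJoint q P ∧ margFst P = W ∧
    D = klDist (margSnd P 1) (margSnd P 0)}

end

/-!
The code is transferred to another channel to the receiver. Let `P` be a maximal coupling whose
first marginal is `W`, and `U` its second marginal. Under `P`, each letter of the codeword
maximizes `q(·, ŷ) / q(·, y)`, so a message that beats the transmitted one at `ŷ` also beats it at
`y` (`metricPow_le_of_maximizers`). Hence the same code with the same metric has on `U` at most the
error probability that it has on `W` (`errProb_margSnd_le`), and the ordinary converse for `U`
applies.

Both parts of that converse use the variational bound
`E_P g - E_Q exp g + 1 ≤ D(P ‖ Q)` (`klFunctional_le_klDist`).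

* With `g = log |M|` on a decoding region and `0` elsewhere, averaged over the messages and keys, it
  gives `(1 - ε) log |M| ≤ 1 + N * D(U₁ ‖ U₀)`, where `N` is the average number of non-innocent
  letters in a codeword (`log_numMsg_le_avgWeight`).
* At the warden, `g` is an additive function with letters `s (Q₁ - Q₀) / Q₀ - c`. Its expectation is
  affine in `N`, and with `s = t_δ / √n` a second-order expansion gives
  `N ≤ t_δ √n (1 + o(1))` (`eventually_avgWeight_div_sqrt_le`).

Together, `R ≤ t_δ * D(U₁ ‖ U₀)` for every maximal coupling for which the divergence is finite. The
minimum over the couplings exists because they form a compact set, on which the divergence, as a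
supremum of the continuous functionals above (`klDist_eq_iSup`), is lower semicontinuous; it is
finite because the coupling `Ŷ = Y` is maximal and `W₁ ≪ W₀`.
-/

/-! ### Product distributions -/

theorem sum_prod_eq_prod_sum {A : Type*} [Fintype A] {n : ℕ} (f : Fin n → A → ℝ) :
    ∑ y : Fin n → A, ∏ i, f i (y i) = ∏ i, ∑ a, f i a := by
  classical
  rw [Finset.prod_univ_sum, Fintype.piFinset_univ]

/-- The expectation of an additive function under a product of probability vectors. -/
theorem sum_prod_mul_sum {A : Type*} [Fintype A] {n : ℕ} {p : Fin n → A → ℝ}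
    (hp : ∀ i, ∑ a, p i a = 1) (f : Fin n → A → ℝ) :
    ∑ y : Fin n → A, (∏ i, p i (y i)) * ∑ j, f j (y j) = ∑ j, ∑ a, p j a * f j a := by
  classical
  simp_rw [Finset.mul_sum]
  rw [Finset.sum_comm]
  refine Finset.sum_congr rfl fun j _ => ?_
  have h : ∀ y : Fin n → A, (∏ i, p i (y i)) * f j (y j)
      = ∏ i, (p i (y i) * if i = j then f i (y i) else 1) := fun y => by
    rw [Finset.prod_mul_distrib, Fintype.prod_eq_single (f := fun i => if i = j then _ else _) j]
    · simp
    · intro i hi; simp [hi]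
  simp_rw [h]
  rw [sum_prod_eq_prod_sum (fun i a => p i a * if i = j then f i a else 1),
    Fintype.prod_eq_single j]
  · simp
  · intro i hi; simp [hi, hp]

/-! ### The variational formula for the divergence -/

/-- The functional whose supremum over all `g` is the divergence of `P` from `Q`: a variant of the
Donsker–Varadhan functional that is affine in `(P, Q)`. -/
noncomputable def klFunctional {A : Type*} [Fintype A] (g P Q : A → ℝ) : ℝ :=
  ∑ a, P a * g a - ∑ a, Q a * Real.exp (g a) + 1

/-- Termwise, this is `1 + u ≤ exp u` with `u = g a - log (P a / Q a)`. -/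
theorem klFunctional_le_sum {A : Type*} [Fintype A] {P Q : A → ℝ} (hP : P ∈ stdSimplex ℝ A)
    (hQ : ∀ a, 0 ≤ Q a) (hac : AbsCont P Q) (g : A → ℝ) :
    klFunctional g P Q ≤ ∑ a, P a * Real.log (P a / Q a) := by
  have key : ∀ a, P a * g a - Q a * Real.exp (g a) + P a ≤ P a * Real.log (P a / Q a) := by
    intro a
    rcases (hP.1 a).eq_or_lt with h0 | hpos
    · rw [← h0]
      have := mul_nonneg (hQ a) (Real.exp_pos (g a)).le
      simp only [zero_mul]; linarith
    · have hq : 0 < Q a := (hQ a).lt_of_ne fun h => hpos.ne' (hac a h.symm)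
      have h1 := Real.add_one_le_exp (g a - Real.log (P a / Q a))
      rw [Real.exp_sub, Real.exp_log (div_pos hpos hq)] at h1
      have h2 := mul_le_mul_of_nonneg_left h1 hpos.le
      have h3 : P a * (Real.exp (g a) / (P a / Q a)) = Q a * Real.exp (g a) := by
        field_simp
      rw [h3] at h2
      linarith
  have h := Finset.sum_le_sum fun a (_ : a ∈ Finset.univ) => key a
  rw [Finset.sum_add_distrib, Finset.sum_sub_distrib, hP.2] at h
  exact h

theorem klFunctional_le_klDist {A : Type*} [Fintype A] {P Q : A → ℝ} (hP : P ∈ stdSimplex ℝ A)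
    (hQ : ∀ a, 0 ≤ Q a) (g : A → ℝ) : (klFunctional g P Q : EReal) ≤ klDist P Q := by
  unfold klDist
  split_ifs with hac
  · exact_mod_cast klFunctional_le_sum hP hQ hac g
  · exact le_top

theorem klDist_eq_iSup {A : Type*} [Fintype A] {P Q : A → ℝ} (hP : P ∈ stdSimplex ℝ A)
    (hQ : ∀ a, 0 ≤ Q a) : klDist P Q = ⨆ g : A → ℝ, (klFunctional g P Q : EReal) := by
  classical
  refine le_antisymm ?_ (iSup_le fun g => klFunctional_le_klDist hP hQ g)
  unfold klDist
  split_ifs with hac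
  · -- The optimal `g` is `log (P / Q)`, with value `-∞` where `P` vanishes; hence the limit.
    let g : ℕ → A → ℝ := fun T a => if P a = 0 then -(T : ℝ) else Real.log (P a / Q a)
    have hlim : Tendsto (fun T => klFunctional (g T) P Q) atTop
        (𝓝 (∑ a, P a * Real.log (P a / Q a))) := by
      have h1 : ∀ a, Tendsto (fun T => P a * g T a - Q a * Real.exp (g T a) + P a) atTop
          (𝓝 (P a * Real.log (P a / Q a))) := by
        intro a
        by_cases h0 : P a = 0
        · simp only [g, h0, if_true, zero_mul, zero_sub, add_zero]
          have := (Real.tendsto_exp_neg_atTop_nhds_zero.comp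
            tendsto_natCast_atTop_atTop).const_mul (Q a)
          simpa using this.neg
        · have hpos : 0 < P a := (hP.1 a).lt_of_ne (Ne.symm h0)
          have hq : 0 < Q a := (hQ a).lt_of_ne fun h => h0 (hac a h.symm)
          simp only [g, h0, if_false, Real.exp_log (div_pos hpos hq)]
          rw [mul_div_cancel₀ _ hq.ne']
          simp
      have h2 := tendsto_finsetSum Finset.univ fun a _ => h1 a
      refine h2.congr fun T => ?_
      rw [Finset.sum_add_distrib, Finset.sum_sub_distrib, hP.2]
      rfl
    exact le_of_tendsto' ((continuous_coe_real_ereal.tendsto _).comp hlim)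
      fun T => le_iSup (fun g : A → ℝ => (klFunctional g P Q : EReal)) (g T)
  · -- A large `g` at an atom of `P` that is not an atom of `Q`.
    simp only [AbsCont, not_forall] at hac
    obtain ⟨a, ha0, ha1⟩ := hac
    have hpos : 0 < P a := (hP.1 a).lt_of_ne (Ne.symm ha1)
    rw [top_le_iff, EReal.eq_top_iff_forall_lt]
    intro y
    let T : ℝ := (y + ∑ b, Q b) / P a
    refine lt_of_lt_of_le ?_ (le_iSup (fun g : A → ℝ => (klFunctional g P Q : EReal))
      (fun b => if b = a then T else 0))
    have hs : ∑ b, Q b * Real.exp (if b = a then T else 0) = ∑ b, Q b := by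
      refine Finset.sum_congr rfl fun b _ => ?_
      split_ifs with h
      · rw [h, ha0, zero_mul]
      · simp
    have hT : P a * T = y + ∑ b, Q b := mul_div_cancel₀ _ hpos.ne'
    rw [EReal.coe_lt_coe_iff, klFunctional, hs]
    simp only [mul_ite, mul_zero, Finset.sum_ite_eq', Finset.mem_univ, if_true, hT]
    linarith

/-! ### Existence of the minimal divergence -/

theorem isCompact_setOf_isMaximalJoint {Y : Type*} [Fintype Y] (W q : Fin 2 → Y → ℝ) :
    IsCompact {P : Fin 2 → Y × Y → ℝ | IsMaximalJoint q P ∧ margFst P = W} := by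
  have hK : IsCompact (Set.pi Set.univ fun _ : Fin 2 => stdSimplex ℝ (Y × Y)) :=
    isCompact_univ_pi fun _ => isCompact_stdSimplex ℝ (Y × Y)
  refine hK.of_isClosed_subset ?_ fun P hP x _ => hP.1.1 x
  have h1 : IsClosed {P : Fin 2 → Y × Y → ℝ | ∀ x, P x ∈ stdSimplex ℝ (Y × Y)} := by
    simpa [Set.pi] using hK.isClosed
  have h2 : IsClosed {P : Fin 2 → Y × Y → ℝ |
      ∀ y yh x, x ∉ maximizers q y yh → P x (y, yh) = 0} := by
    simp only [Set.ofPred_forall]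
    exact isClosed_iInter fun y => isClosed_iInter fun yh => isClosed_iInter fun x =>
      isClosed_iInter fun _ => isClosed_eq (by fun_prop) continuous_const
  have h3 : IsClosed {P : Fin 2 → Y × Y → ℝ | margFst P = W} :=
    isClosed_eq (by unfold margFst; fun_prop) continuous_const
  exact (h1.inter h2).inter h3

theorem isChannel_margSnd {Y : Type*} [Fintype Y] {P : Fin 2 → Y × Y → ℝ}
    (hP : ∀ x, P x ∈ stdSimplex ℝ (Y × Y)) : IsChannel (margSnd P) := by
  intro x
  refine ⟨fun y => Finset.sum_nonneg fun a _ => (hP x).1 _, ?_⟩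
  rw [← (hP x).2, Fintype.sum_prod_type_right]
  rfl

open Classical in
/-- The coupling `Ŷ = Y` is maximal, since every input maximizes `q(x, y) / q(x, y)`. -/
theorem isMaximalJoint_diagonal {Y : Type*} [Fintype Y] {W q : Fin 2 → Y → ℝ}
    (hW : IsChannel W) (hq : ∀ x y, 0 < q x y) :
    IsMaximalJoint q fun x p => if p.1 = p.2 then W x p.1 else 0 := by
  refine ⟨fun x => ⟨fun p => ?_, ?_⟩, fun y yh x hx => if_neg fun h => hx ?_⟩
  · dsimp only
    split_ifs
    exacts [(hW x).1 _, le_rfl]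
  · simp [Fintype.sum_prod_type, (hW x).2]
  · intro x'
    dsimp only at h
    rw [h, div_self (hq _ _).ne', div_self (hq _ _).ne']

theorem exists_isLeast_maximalDivergences {Y : Type*} [Fintype Y] {W q : Fin 2 → Y → ℝ}
    (hW : IsChannel W) (hPac : AbsCont (W 1) (W 0)) (hq : ∀ x y, 0 < q x y) :
    ∃ D : ℝ, IsLeast (maximalDivergences W q) (D : EReal) := by
  classical
  set S := {P : Fin 2 → Y × Y → ℝ | IsMaximalJoint q P ∧ margFst P = W} with hS
  set P₀ : Fin 2 → Y × Y → ℝ := fun x p => if p.1 = p.2 then W x p.1 else 0 with hP₀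
  have hm1 : margFst P₀ = W := by
    funext x y; simp [margFst, hP₀]
  have hm2 : margSnd P₀ = W := by
    funext x y; simp [margSnd, hP₀]
  have hmem : P₀ ∈ S := ⟨isMaximalJoint_diagonal hW hq, hm1⟩
  have hlsc : LowerSemicontinuousOn (fun P : Fin 2 → Y × Y → ℝ =>
      ⨆ g : Y → ℝ, (klFunctional g (margSnd P 1) (margSnd P 0) : EReal)) S := by
    refine (lowerSemicontinuous_iSup fun g => Continuous.lowerSemicontinuous
      (continuous_coe_real_ereal.comp ?_)).lowerSemicontinuousOn _
    unfold klFunctional margSnd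
    fun_prop
  have heq : ∀ P ∈ S, klDist (margSnd P 1) (margSnd P 0)
      = ⨆ g : Y → ℝ, (klFunctional g (margSnd P 1) (margSnd P 0) : EReal) := fun P hP =>
    klDist_eq_iSup (isChannel_margSnd hP.1.1 1) (isChannel_margSnd hP.1.1 0).1
  obtain ⟨P, hP, hmin⟩ :=
    hlsc.exists_isMinOn ⟨P₀, hmem⟩ (isCompact_setOf_isMaximalJoint W q)
  have hle : ∀ P' ∈ S, klDist (margSnd P 1) (margSnd P 0)
      ≤ klDist (margSnd P' 1) (margSnd P' 0) := fun P' hP' => by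
    rw [heq P hP, heq P' hP']; exact hmin hP'
  have hac : AbsCont (margSnd P 1) (margSnd P 0) := by
    by_contra hac
    have h := hle P₀ hmem
    rw [hm2, klDist, klDist, if_neg hac, if_pos hPac] at h
    exact EReal.coe_ne_top _ (top_le_iff.1 h)
  refine ⟨∑ a, margSnd P 1 a * Real.log (margSnd P 1 a / margSnd P 0 a),
    ⟨P, hP.1, hP.2, by rw [klDist, if_pos hac]⟩, ?_⟩
  rintro _ ⟨P', h1, h2, rfl⟩
  have h := hle P' ⟨h1, h2⟩
  rwa [klDist, if_pos hac] at h

/-! ### Transfer of the code to the second output of a maximal coupling -/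

/-- If `x` maximizes `q(·, ŷ) / q(·, y)` letterwise, then an input preferred to `x` at the output
`ŷ` is also preferred to `x` at `y`. -/
theorem metricPow_le_of_maximizers {Y : Type*} {n : ℕ} {q : Fin 2 → Y → ℝ}
    (hq : ∀ x y, 0 < q x y) {x x' : Fin n → Fin 2} {y yh : Fin n → Y}
    (hx : ∀ i, x i ∈ maximizers q (y i) (yh i))
    (h : metricPow q x yh ≤ metricPow q x' yh) : metricPow q x y ≤ metricPow q x' y := by
  have hpos : ∀ (u : Fin n → Fin 2) (v : Fin n → Y), 0 < metricPow q u v := fun u v =>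
    Finset.prod_pos fun i _ => hq _ _
  have h1 : metricPow q x' yh / metricPow q x' y ≤ metricPow q x yh / metricPow q x y := by
    unfold metricPow
    rw [← Finset.prod_div_distrib, ← Finset.prod_div_distrib]
    exact Finset.prod_le_prod (fun i _ => (div_pos (hq _ _) (hq _ _)).le) fun i _ => hx i (x' i)
  rw [div_le_div_iff₀ (hpos _ _) (hpos _ _)] at h1
  have h2 := mul_le_mul_of_nonneg_right h (hpos x y).le
  exact le_of_mul_le_mul_left (h2.trans h1) (hpos x yh)

/-- The code is no worse on the channel to the second output of a maximal coupling than on the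
channel to the first: under the coupling, an error at `Ŷ` forces an error at `Y`. -/
theorem errProb_margSnd_le {Y : Type*} [Fintype Y] {n : ℕ} {q : Fin 2 → Y → ℝ}
    (hq : ∀ x y, 0 < q x y) {P : Fin 2 → Y × Y → ℝ} (hP : IsMaximalJoint q P) (C : Code n)
    (m : Fin C.numMsg) (k : Fin C.numKey) :
    C.errProb (margSnd P) q m k ≤ C.errProb (margFst P) q m k := by
  classical
  have hsnd : ∀ yh : Fin n → Y, chanPow (margSnd P) (C.codeword m k) yh
      = ∑ y : Fin n → Y, ∏ i, P (C.codeword m k i) (y i, yh i) := fun yh =>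
    (sum_prod_eq_prod_sum fun i a => P (C.codeword m k i) (a, yh i)).symm
  have hfst : ∀ y : Fin n → Y, chanPow (margFst P) (C.codeword m k) y
      = ∑ yh : Fin n → Y, ∏ i, P (C.codeword m k i) (y i, yh i) := fun y =>
    (sum_prod_eq_prod_sum fun i a => P (C.codeword m k i) (y i, a)).symm
  unfold Code.errProb
  simp_rw [← Finset.sum_filter, hsnd, hfst, Finset.sum_filter]
  have hite : ∀ (p : Prop) [Decidable p] (f : (Fin n → Y) → ℝ),
      (if p then ∑ y, f y else 0) = ∑ y, if p then f y else 0 := fun p _ f => by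
    split_ifs <;> simp
  simp_rw [hite]
  rw [Finset.sum_comm]
  refine Finset.sum_le_sum fun y _ => Finset.sum_le_sum fun yh _ => ?_
  have hnn : 0 ≤ ∏ i, P (C.codeword m k i) (y i, yh i) :=
    Finset.prod_nonneg fun i _ => (hP.1 _).1 _
  by_cases h0 : ∏ i, P (C.codeword m k i) (y i, yh i) = 0
  · simp [h0]
  have hx : ∀ i, C.codeword m k i ∈ maximizers q (y i) (yh i) := fun i => by
    by_contra hi
    exact h0 (Finset.prod_eq_zero (Finset.mem_univ i) (hP.2 _ _ _ hi))
  by_cases herr : ∃ m', m' ≠ m ∧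
      metricPow q (C.codeword m k) yh ≤ metricPow q (C.codeword m' k) yh
  · have herr' : ∃ m', m' ≠ m ∧
        metricPow q (C.codeword m k) y ≤ metricPow q (C.codeword m' k) y := by
      obtain ⟨m', hm', hle⟩ := herr
      exact ⟨m', hm', metricPow_le_of_maximizers hq hx hle⟩
    rw [if_pos herr, if_pos herr']
  · rw [if_neg herr]
    split_ifs
    exacts [hnn, le_rfl]

/-! ### Converse in terms of the weight of the codewords -/

/-- The number of non-innocent letters of an input sequence. -/
noncomputable def inputWeight {n : ℕ} (x : Fin n → Fin 2) : ℝ := ∑ i, if x i = 1 then 1 else 0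

theorem chanPow_mem_stdSimplex {Y : Type*} [Fintype Y] {n : ℕ} {U : Fin 2 → Y → ℝ}
    (hU : IsChannel U) (x : Fin n → Fin 2) : chanPow U x ∈ stdSimplex ℝ (Fin n → Y) := by
  refine ⟨fun y => Finset.prod_nonneg fun i _ => (hU _).1 _, ?_⟩
  unfold chanPow
  rw [sum_prod_eq_prod_sum fun i => U (x i)]
  simp [(hU _).2]

/-- The expectation of an additive function of the channel output depends on the input only
through its weight. -/
theorem sum_chanPow_mul_sum {Y : Type*} [Fintype Y] {n : ℕ} {U : Fin 2 → Y → ℝ}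
    (hU : IsChannel U) (x : Fin n → Fin 2) (h : Y → ℝ) :
    ∑ y : Fin n → Y, chanPow U x y * ∑ i, h (y i)
      = n * ∑ a, U 0 a * h a + inputWeight x * (∑ a, U 1 a * h a - ∑ a, U 0 a * h a) := by
  unfold chanPow
  rw [sum_prod_mul_sum (fun i => (hU (x i)).2) fun _ => h, inputWeight, Finset.sum_mul]
  have hn : (n : ℝ) * ∑ a, U 0 a * h a = ∑ _i : Fin n, ∑ a, U 0 a * h a := by simp
  rw [hn, ← Finset.sum_add_distrib]
  refine Finset.sum_congr rfl fun i _ => ?_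
  rcases Fin.exists_fin_two.1 ⟨x i, rfl⟩ with h0 | h1
  · simp [h0]
  · simp [h1]

/-- The divergence of the channel output from the output at the innocent input is additive over
the non-innocent letters. -/
theorem sum_chanPow_mul_log {Y : Type*} [Fintype Y] {n : ℕ} {U : Fin 2 → Y → ℝ}
    (hU : IsChannel U) (hac : AbsCont (U 1) (U 0)) (x : Fin n → Fin 2) :
    ∑ y : Fin n → Y, chanPow U x y * Real.log (chanPow U x y / prodDist n (U 0) y)
      = inputWeight x * ∑ a, U 1 a * Real.log (U 1 a / U 0 a) := by
  have hstep : ∀ y : Fin n → Y,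
      chanPow U x y * Real.log (chanPow U x y / prodDist n (U 0) y)
        = (∏ i, U (x i) (y i)) * ∑ i, Real.log (U (x i) (y i) / U 0 (y i)) := by
    intro y
    by_cases h0 : ∏ i, U (x i) (y i) = 0
    · simp [chanPow, h0]
    · unfold chanPow prodDist
      rw [← Finset.prod_div_distrib, Real.log_prod]
      intro i _
      have hne : U (x i) (y i) ≠ 0 := fun h => h0 (Finset.prod_eq_zero (Finset.mem_univ i) h)
      refine div_ne_zero hne fun h => hne ?_
      rcases Fin.exists_fin_two.1 ⟨x i, rfl⟩ with hx | hx
      · rw [hx, h]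
      · rw [hx, hac _ h]
  simp_rw [hstep]
  rw [sum_prod_mul_sum (fun i => (hU (x i)).2) fun i a => Real.log (U (x i) a / U 0 a),
    inputWeight, Finset.sum_mul]
  refine Finset.sum_congr rfl fun i _ => ?_
  rcases Fin.exists_fin_two.1 ⟨x i, rfl⟩ with hx | hx
  · rw [hx]
    simp only [zero_ne_one, if_false, zero_mul]
    refine Finset.sum_eq_zero fun a _ => ?_
    by_cases h : U 0 a = 0
    · simp [h]
    · simp [div_self h]
  · simp [hx]

theorem absCont_chanPow {Y : Type*} {n : ℕ} {U : Fin 2 → Y → ℝ} (hac : AbsCont (U 1) (U 0))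
    (x : Fin n → Fin 2) : AbsCont (chanPow U x) (prodDist n (U 0)) := by
  intro y hy
  obtain ⟨i, -, hi⟩ := Finset.prod_eq_zero_iff.1 hy
  refine Finset.prod_eq_zero (Finset.mem_univ i) ?_
  rcases Fin.exists_fin_two.1 ⟨x i, rfl⟩ with hx | hx
  · rw [hx, hi]
  · rw [hx, hac _ hi]

theorem prodDist_mem_stdSimplex {A : Type*} [Fintype A] {p : A → ℝ} (hp : p ∈ stdSimplex ℝ A)
    (n : ℕ) : prodDist n p ∈ stdSimplex ℝ (Fin n → A) := by
  refine ⟨fun y => Finset.prod_nonneg fun i _ => hp.1 _, ?_⟩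
  unfold prodDist
  rw [sum_prod_eq_prod_sum fun _ => p]
  simp [hp.2]

/-- Converse for the codewords of one key: the decoding regions are disjoint, while each of them is
likely under its codeword, so on average the codewords are far from the innocent input. -/
theorem numMsg_mul_log_le {Y : Type*} [Fintype Y] {n : ℕ} {U q : Fin 2 → Y → ℝ}
    (hU : IsChannel U) (hac : AbsCont (U 1) (U 0)) (C : Code n) (k : Fin C.numKey) {ε : ℝ}
    (hε : ∀ m, C.errProb U q m k ≤ ε) :
    (C.numMsg : ℝ) * ((1 - ε) * Real.log C.numMsg) ≤ C.numMsg +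
      (∑ m, inputWeight (C.codeword m k)) * ∑ a, U 1 a * Real.log (U 1 a / U 0 a) := by
  classical
  have hM : (1 : ℝ) ≤ C.numMsg := by exact_mod_cast C.numMsg_pos
  have hlog : 0 ≤ Real.log C.numMsg := Real.log_nonneg hM
  set Q := prodDist n (U 0) with hQ
  have hQs : Q ∈ stdSimplex ℝ (Fin n → Y) := prodDist_mem_stdSimplex (hU 0) n
  let E : Fin C.numMsg → (Fin n → Y) → Prop := fun m y =>
    ∃ m', m' ≠ m ∧ metricPow q (C.codeword m k) y ≤ metricPow q (C.codeword m' k) y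
  -- The variational formula is applied with `log |M|` on the decoding region, `0` elsewhere.
  let g : Fin C.numMsg → (Fin n → Y) → ℝ := fun m y => if E m y then 0 else Real.log C.numMsg
  have hg : ∀ m, (1 - ε) * Real.log C.numMsg ≤ ∑ y, chanPow U (C.codeword m k) y * g m y := by
    intro m
    have h1 : ∑ y, chanPow U (C.codeword m k) y * g m y
        = (1 - C.errProb U q m k) * Real.log C.numMsg := by
      rw [← (chanPow_mem_stdSimplex hU (C.codeword m k)).2, Code.errProb,
        ← Finset.sum_sub_distrib, Finset.sum_mul]
      refine Finset.sum_congr rfl fun y _ => ?_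
      by_cases h : E m y
      · have h' := h
        simp only [E] at h'
        simp [g, h, h']
      · have h' := h
        simp only [E] at h'
        simp only [g, if_neg h, if_neg h', sub_zero]
    rw [h1]
    exact mul_le_mul_of_nonneg_right (by linarith [hε m]) hlog
  have hone : ∀ y, ∑ m, (if E m y then (0 : ℝ) else 1) ≤ 1 := by
    intro y
    by_cases h : ∃ m, ¬ E m y
    · obtain ⟨m, hm⟩ := h
      rw [Fintype.sum_eq_single m fun m' hne => ?_]
      · rw [if_neg hm]
      · refine if_pos ?_
        by_contra h'
        have ha : ¬ metricPow q (C.codeword m' k) y ≤ metricPow q (C.codeword m k) y :=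
          fun h => h' ⟨m, hne.symm, h⟩
        have hb : ¬ metricPow q (C.codeword m k) y ≤ metricPow q (C.codeword m' k) y :=
          fun h => hm ⟨m', hne, h⟩
        exact (le_total _ _).elim ha hb
    · push Not at h
      simp [h]
  have hexp : ∑ m, ∑ y, Q y * Real.exp (g m y) ≤ C.numMsg + C.numMsg := by
    have h1 : ∀ m y, Q y * Real.exp (g m y)
        = Q y + Q y * (((C.numMsg : ℝ) - 1) * if E m y then 0 else 1) := by
      intro m y
      by_cases h : E m y
      · simp [g, h]
      · simp only [g, if_neg h, Real.exp_log (lt_of_lt_of_le one_pos hM)]; ring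
    simp_rw [h1, Finset.sum_add_distrib, hQs.2]
    rw [Finset.sum_comm]
    simp_rw [← Finset.mul_sum]
    have h2 : ∑ y, Q y * (((C.numMsg : ℝ) - 1) * ∑ m, if E m y then (0 : ℝ) else 1)
        ≤ ∑ y, Q y * ((C.numMsg : ℝ) - 1) := Finset.sum_le_sum fun y _ =>
      mul_le_mul_of_nonneg_left (mul_le_of_le_one_right (by linarith) (hone y)) (hQs.1 y)
    rw [← Finset.sum_mul, hQs.2] at h2
    simp only [Finset.sum_const, Finset.card_univ, Fintype.card_fin, nsmul_eq_mul, mul_one]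
    linarith
  have hvar : ∑ m, klFunctional (g m) (chanPow U (C.codeword m k)) Q
      ≤ ∑ m, inputWeight (C.codeword m k) * ∑ a, U 1 a * Real.log (U 1 a / U 0 a) := by
    refine Finset.sum_le_sum fun m _ => ?_
    rw [← sum_chanPow_mul_log hU hac]
    exact klFunctional_le_sum (chanPow_mem_stdSimplex hU _) hQs.1 (absCont_chanPow hac _) _
  have hsum := Finset.sum_le_sum fun m (_ : m ∈ Finset.univ) => hg m
  simp only [klFunctional, Finset.sum_add_distrib, Finset.sum_sub_distrib] at hvar
  rw [← Finset.sum_mul] at hvar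
  simp only [Finset.sum_const, Finset.card_univ, Fintype.card_fin, nsmul_eq_mul, mul_one]
    at hvar hsum
  linarith

/-- The average weight of the codewords. -/
noncomputable def Code.avgWeight {n : ℕ} (C : Code n) : ℝ :=
  1 / ((C.numMsg : ℝ) * (C.numKey : ℝ)) * ∑ m, ∑ k, inputWeight (C.codeword m k)

/-- Up to the factor `1 - ε` and an additive constant, a code of error probability `ε` carries at
most the divergence `D(U₁ ‖ U₀)` per non-innocent letter. -/
theorem log_numMsg_le_avgWeight {Y : Type*} [Fintype Y] {n : ℕ} {U q : Fin 2 → Y → ℝ}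
    (hU : IsChannel U) (hac : AbsCont (U 1) (U 0)) (C : Code n) {ε : ℝ}
    (hε : ∀ m k, C.errProb U q m k ≤ ε) :
    (1 - ε) * Real.log C.numMsg
      ≤ 1 + C.avgWeight * ∑ a, U 1 a * Real.log (U 1 a / U 0 a) := by
  have hM : (0 : ℝ) < C.numMsg := by exact_mod_cast C.numMsg_pos
  have hK : (0 : ℝ) < C.numKey := by exact_mod_cast C.numKey_pos
  have h := Finset.sum_le_sum fun k (_ : k ∈ Finset.univ) =>
    numMsg_mul_log_le (q := q) hU hac C k fun m => hε m k
  have hcomm := Finset.sum_comm (s := Finset.univ) (t := Finset.univ)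
    (f := fun k m => inputWeight (C.codeword m k))
  rw [← Finset.sum_mul, Finset.sum_add_distrib, ← Finset.sum_mul, hcomm] at h
  simp only [Finset.sum_const, Finset.card_univ, Fintype.card_fin, nsmul_eq_mul] at h
  rw [Code.avgWeight]
  set D := ∑ a, U 1 a * Real.log (U 1 a / U 0 a)
  set S := ∑ m, ∑ k, inputWeight (C.codeword m k)
  refine le_of_mul_le_mul_left ?_ (mul_pos hM hK)
  have h2 : (C.numMsg : ℝ) * C.numKey * (1 + 1 / (C.numMsg * C.numKey) * S * D)
      = C.numMsg * C.numKey + S * D := by field_simp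
  rw [h2]
  linarith

/-! ### The covertness constraint bounds the average weight -/

theorem wardenDist_mem_stdSimplex {Z : Type*} [Fintype Z] {n : ℕ} {V : Fin 2 → Z → ℝ}
    (hV : IsChannel V) (C : Code n) : C.wardenDist V ∈ stdSimplex ℝ (Fin n → Z) := by
  have hM : (C.numMsg : ℝ) ≠ 0 := by exact_mod_cast C.numMsg_pos.ne'
  have hK : (C.numKey : ℝ) ≠ 0 := by exact_mod_cast C.numKey_pos.ne'
  refine ⟨fun z => mul_nonneg (by positivity) (Finset.sum_nonneg fun m _ =>
    Finset.sum_nonneg fun k _ => (chanPow_mem_stdSimplex hV _).1 z), ?_⟩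
  unfold Code.wardenDist
  rw [← Finset.mul_sum, Finset.sum_comm]
  have h : ∀ m, ∑ z, ∑ k, chanPow V (C.codeword m k) z = C.numKey := fun m => by
    rw [Finset.sum_comm]; simp [(chanPow_mem_stdSimplex hV _).2]
  simp_rw [h]
  simp only [Finset.sum_const, Finset.card_univ, Fintype.card_fin, nsmul_eq_mul]
  field_simp

theorem sum_wardenDist_mul_sum {Z : Type*} [Fintype Z] {n : ℕ} {V : Fin 2 → Z → ℝ}
    (hV : IsChannel V) (C : Code n) (h : Z → ℝ) :
    ∑ z : Fin n → Z, C.wardenDist V z * ∑ i, h (z i)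
      = n * ∑ a, V 0 a * h a + C.avgWeight * (∑ a, V 1 a * h a - ∑ a, V 0 a * h a) := by
  have hM : (C.numMsg : ℝ) ≠ 0 := by exact_mod_cast C.numMsg_pos.ne'
  have hK : (C.numKey : ℝ) ≠ 0 := by exact_mod_cast C.numKey_pos.ne'
  unfold Code.wardenDist Code.avgWeight
  simp_rw [mul_assoc, ← Finset.mul_sum, Finset.sum_mul]
  rw [Finset.sum_comm]
  have h1 : ∀ m, ∑ z : Fin n → Z, ∑ k, chanPow V (C.codeword m k) z * ∑ i, h (z i)
      = ∑ k, (n * ∑ a, V 0 a * h a + inputWeight (C.codeword m k) *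
        (∑ a, V 1 a * h a - ∑ a, V 0 a * h a)) := fun m => by
    rw [Finset.sum_comm]
    exact Finset.sum_congr rfl fun k _ => sum_chanPow_mul_sum hV _ h
  simp_rw [h1, Finset.sum_add_distrib, ← Finset.sum_mul]
  simp only [Finset.sum_const, Finset.card_univ, Fintype.card_fin, nsmul_eq_mul]
  field_simp

/-- The density `(Q₁ - Q₀) / Q₀`. Division by zero makes it `0` outside the support of `Q₀`; if
`Q₁ ≪ Q₀`, it is still a density of `Q₁ - Q₀` with respect to `Q₀` (`mul_relDiff`). -/
noncomputable def relDiff {Z : Type*} (V : Fin 2 → Z → ℝ) (z : Z) : ℝ := (V 1 z - V 0 z) / V 0 z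

theorem mul_relDiff {Z : Type*} {V : Fin 2 → Z → ℝ} (hac : AbsCont (V 1) (V 0)) (z : Z) :
    V 0 z * relDiff V z = V 1 z - V 0 z := by
  by_cases h : V 0 z = 0
  · simp [h, hac z h]
  · exact mul_div_cancel₀ _ h

theorem sum_mul_relDiff {Z : Type*} [Fintype Z] {V : Fin 2 → Z → ℝ} (hV : IsChannel V)
    (hac : AbsCont (V 1) (V 0)) : ∑ z, V 0 z * relDiff V z = 0 := by
  simp_rw [mul_relDiff hac, Finset.sum_sub_distrib, (hV _).2, sub_self]

theorem sum_mul_relDiff_sq {Z : Type*} [Fintype Z] {V : Fin 2 → Z → ℝ}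
    (hac : AbsCont (V 1) (V 0)) : ∑ z, V 0 z * relDiff V z ^ 2 = chiSq (V 1) (V 0) := by
  refine Finset.sum_congr rfl fun z _ => ?_
  rw [sq, ← mul_assoc, mul_relDiff hac, relDiff]
  ring

theorem sum_mul_relDiff_one {Z : Type*} [Fintype Z] {V : Fin 2 → Z → ℝ} (hV : IsChannel V)
    (hac : AbsCont (V 1) (V 0)) : ∑ z, V 1 z * relDiff V z = chiSq (V 1) (V 0) := by
  rw [← sub_zero (∑ z, _), ← sum_mul_relDiff hV hac, ← Finset.sum_sub_distrib]
  refine Finset.sum_congr rfl fun z _ => ?_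
  rw [relDiff]
  ring

theorem chiSq_pos {Z : Type*} [Fintype Z] {V : Fin 2 → Z → ℝ} (hV : IsChannel V)
    (hne : V 0 ≠ V 1) (hac : AbsCont (V 1) (V 0)) : 0 < chiSq (V 1) (V 0) := by
  obtain ⟨z, hz⟩ := Function.ne_iff.1 hne
  refine Finset.sum_pos' (fun a _ => div_nonneg (sq_nonneg _) ((hV 0).1 a))
    ⟨z, Finset.mem_univ z, ?_⟩
  have h0 : 0 < V 0 z := ((hV 0).1 z).lt_of_ne fun h => hz (by rw [← h, hac z h.symm])
  exact div_pos (sq_pos_of_ne_zero (sub_ne_zero.2 (Ne.symm hz))) h0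

theorem exp_le_quadratic_add_cubic {u : ℝ} (hu : |u| ≤ 1) :
    Real.exp u ≤ 1 + u + u ^ 2 / 2 + |u| ^ 3 := by
  have h := (abs_le.1 (Real.exp_bound hu (n := 3) (by norm_num))).2
  norm_num [Finset.sum_range_succ, Nat.factorial] at h
  have h3 : 0 ≤ |u| ^ 3 := by positivity
  linarith

/-- The divergence at the warden is tested against the additive function with the letters
`s (Q₁ - Q₀) / Q₀ - c`, where `c` makes the exponential moment under `Q₀` at most `1`. -/
theorem avgWeight_mul_chiSq_le {Z : Type*} [Fintype Z] {n : ℕ} {V : Fin 2 → Z → ℝ}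
    (hV : IsChannel V) (hac : AbsCont (V 1) (V 0)) (C : Code n) {s : ℝ} (hs : 0 ≤ s)
    (hs1 : ∀ z, s * |relDiff V z| ≤ 1) :
    ((C.avgWeight * (s * chiSq (V 1) (V 0)) - n * (s ^ 2 * chiSq (V 1) (V 0) / 2
      + s ^ 3 * ∑ z, V 0 z * |relDiff V z| ^ 3) : ℝ) : EReal)
        ≤ klDist (C.wardenDist V) (prodDist n (V 0)) := by
  set c : ℝ := s ^ 2 * chiSq (V 1) (V 0) / 2 + s ^ 3 * ∑ z, V 0 z * |relDiff V z| ^ 3 with hc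
  have hmom : ∑ z, V 0 z * Real.exp (s * relDiff V z) ≤ 1 + c := by
    have h1 : ∀ z, V 0 z * Real.exp (s * relDiff V z) ≤ V 0 z + s * (V 0 z * relDiff V z)
        + s ^ 2 / 2 * (V 0 z * relDiff V z ^ 2) + s ^ 3 * (V 0 z * |relDiff V z| ^ 3) := by
      intro z
      have habs : |s * relDiff V z| = s * |relDiff V z| := by rw [abs_mul, abs_of_nonneg hs]
      have h := mul_le_mul_of_nonneg_left
        (exp_le_quadratic_add_cubic (u := s * relDiff V z) (habs ▸ hs1 z)) ((hV 0).1 z)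
      rw [habs] at h
      linarith
    have h2 := Finset.sum_le_sum fun z (_ : z ∈ Finset.univ) => h1 z
    simp only [Finset.sum_add_distrib, ← Finset.mul_sum] at h2
    rw [(hV 0).2, sum_mul_relDiff hV hac, sum_mul_relDiff_sq hac] at h2
    linarith
  have hmom' : ∑ z, V 0 z * Real.exp (s * relDiff V z - c) ≤ 1 := by
    simp_rw [Real.exp_sub, ← mul_div_assoc]
    rw [← Finset.sum_div, div_le_one (Real.exp_pos c)]
    linarith [Real.add_one_le_exp c]
  have hmom_n : ∑ z : Fin n → Z, prodDist n (V 0) z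
      * Real.exp (∑ i, (s * relDiff V (z i) - c)) ≤ 1 := by
    simp_rw [prodDist, Real.exp_sum, ← Finset.prod_mul_distrib]
    rw [sum_prod_eq_prod_sum fun _ a => V 0 a * Real.exp (s * relDiff V a - c)]
    exact Finset.prod_le_one (fun _ _ => Finset.sum_nonneg fun a _ =>
      mul_nonneg ((hV 0).1 a) (Real.exp_pos _).le) fun _ _ => hmom'
  refine le_trans ?_ (klFunctional_le_klDist (wardenDist_mem_stdSimplex hV C)
    (prodDist_mem_stdSimplex (hV 0) n).1 fun z => ∑ i, (s * relDiff V (z i) - c))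
  rw [EReal.coe_le_coe_iff, klFunctional,
    sum_wardenDist_mul_sum hV C fun a => s * relDiff V a - c]
  have h0 : ∑ a, V 0 a * (s * relDiff V a - c) = -c := by
    simp_rw [mul_sub, mul_left_comm _ s]
    rw [Finset.sum_sub_distrib, ← Finset.mul_sum, ← Finset.sum_mul, sum_mul_relDiff hV hac,
      (hV 0).2]
    ring
  have h1 : ∑ a, V 1 a * (s * relDiff V a - c) = s * chiSq (V 1) (V 0) - c := by
    simp_rw [mul_sub, mul_left_comm _ s]
    rw [Finset.sum_sub_distrib, ← Finset.mul_sum, ← Finset.sum_mul, sum_mul_relDiff_one hV hac,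
      (hV 1).2]
    ring
  rw [h0, h1]
  linarith

/-! ### The asymptotic bound on achievable rates -/

theorem errProb_le_maxErrProb {Y : Type*} [Fintype Y] {n : ℕ} (C : Code n) (W q : Fin 2 → Y → ℝ)
    (m : Fin C.numMsg) (k : Fin C.numKey) : C.errProb W q m k ≤ C.maxErrProb W q :=
  le_ciSup (f := fun p : Fin C.numMsg × Fin C.numKey => C.errProb W q p.1 p.2)
    (Set.finite_range _).bddAbove (m, k)

/-- Covertness forces an average weight of at most `t √n` asymptotically. -/
theorem eventually_avgWeight_div_sqrt_le {Z : Type*} [Fintype Z] {V : Fin 2 → Z → ℝ}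
    (hV : IsChannel V) (hQne : V 0 ≠ V 1) (hQac : AbsCont (V 1) (V 0)) {δ : ℝ} (hδ : 0 < δ)
    {n : ℕ → ℕ} {C : ∀ j, Code (n j)} (hn : Tendsto n atTop atTop) {d : EReal}
    (hd : d ≤ (δ : EReal))
    (hlim : Tendsto (fun j => klDist ((C j).wardenDist V) (prodDist (n j) (V 0))) atTop (𝓝 d))
    {η : ℝ} (hη : 0 < η) :
    ∀ᶠ j in atTop, (C j).avgWeight / √(n j : ℝ) ≤ weightParam V δ + η := by
  set χ := chiSq (V 1) (V 0) with hχ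
  set t := weightParam V δ with ht
  have hχ0 : 0 < χ := chiSq_pos hV hQne hQac
  have ht2 : t ^ 2 * χ = 2 * δ := by
    rw [ht, weightParam, Real.sq_sqrt (by positivity), div_mul_cancel₀ _ hχ0.ne']
  have ht0 : 0 < t := Real.sqrt_pos.2 (by positivity)
  have hsqrt : Tendsto (fun j => √(n j : ℝ)) atTop atTop :=
    Real.tendsto_sqrt_atTop.comp (tendsto_natCast_atTop_atTop.comp hn)
  set B := ∑ z, V 0 z * |relDiff V z| ^ 3 with hB
  have hκ : 0 < η * t * χ / 2 := by positivity
  have hkl : ∀ᶠ j in atTop, klDist ((C j).wardenDist V) (prodDist (n j) (V 0))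
      < ((δ + η * t * χ / 2 : ℝ) : EReal) :=
    hlim.eventually_lt_const (hd.trans_lt (EReal.coe_lt_coe_iff.2 (by linarith)))
  have hrem : ∀ᶠ j in atTop, t ^ 3 * B / √(n j : ℝ) < η * t * χ / 2 :=
    (hsqrt.const_div_atTop _).eventually_lt_const hκ
  have hsmall : ∀ᶠ j in atTop, ∀ z, t / √(n j : ℝ) * |relDiff V z| ≤ 1 := by
    refine eventually_all.2 fun z => ?_
    have h := (hsqrt.const_div_atTop t).mul_const |relDiff V z|
    rw [zero_mul] at h
    exact h.eventually_le_const one_pos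
  filter_upwards [hkl, hrem, hsmall, hsqrt.eventually_gt_atTop 0] with j h1 h2 h3 h4
  have h5 := (avgWeight_mul_chiSq_le hV hQac (C j) (div_nonneg ht0.le h4.le) h3).trans_lt h1
  rw [EReal.coe_lt_coe_iff] at h5
  have hnn : (n j : ℝ) = √(n j : ℝ) ^ 2 := (Real.sq_sqrt (Nat.cast_nonneg _)).symm
  set r := √(n j : ℝ) with hr
  -- For the exponential tilt `s = t / √n` the quadratic term is exactly `δ`.
  have h6 : (n j : ℝ) * ((t / r) ^ 2 * χ / 2 + (t / r) ^ 3 * B) = δ + t ^ 3 * B / r := by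
    rw [hnn]
    field_simp
    linear_combination r * ht2
  rw [← hχ, ← hB, h6] at h5
  have h7 : (C j).avgWeight * (t / r * χ) = (C j).avgWeight / r * (t * χ) := by ring
  rw [h7] at h5
  refine le_of_mul_le_mul_right ?_ (mul_pos ht0 hχ0)
  have h8 : (t + η) * (t * χ) = 2 * δ + η * t * χ := by linear_combination ht2
  linarith

theorem IsAchievable.rate_le {Y Z : Type*} [Fintype Y] [Fintype Z] {W : Fin 2 → Y → ℝ}
    {V : Fin 2 → Z → ℝ} {q : Fin 2 → Y → ℝ} {δ R RK : ℝ} (h : IsAchievable W V q δ R RK)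
    (hV : IsChannel V) (hQne : V 0 ≠ V 1) (hQac : AbsCont (V 1) (V 0)) (hq : ∀ x y, 0 < q x y)
    (hδ : 0 < δ) {P : Fin 2 → Y × Y → ℝ} (hP : IsMaximalJoint q P) (hPW : margFst P = W)
    (hac : AbsCont (margSnd P 1) (margSnd P 0)) :
    R ≤ weightParam V δ * ∑ a, margSnd P 1 a * Real.log (margSnd P 1 a / margSnd P 0 a) := by
  obtain ⟨n, C, hmono, hR, -, ⟨d, hd, hlim⟩, herr⟩ := h
  have hn : Tendsto n atTop atTop := hmono.tendsto_atTop
  have hU : IsChannel (margSnd P) := isChannel_margSnd hP.1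
  set D := ∑ a, margSnd P 1 a * Real.log (margSnd P 1 a / margSnd P 0 a) with hD
  have hD0 : 0 ≤ D := by
    have h := klFunctional_le_sum (hU 1) (hU 0).1 hac fun _ => 0
    simpa [klFunctional, (hU 0).2] using h
  have hsqrt : Tendsto (fun j => √(n j : ℝ)) atTop atTop :=
    Real.tendsto_sqrt_atTop.comp (tendsto_natCast_atTop_atTop.comp hn)
  have hη : ∀ η : ℝ, 0 < η → R - η ≤ (weightParam V δ + η) * D := by
    intro η hη
    have hrate : ∀ᶠ j in atTop, R - η < Real.log ((C j).numMsg : ℝ) / √(n j : ℝ) := by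
      have h1 : ((R - η : ℝ) : EReal) < (R : EReal) := EReal.coe_lt_coe_iff.2 (by linarith)
      filter_upwards [eventually_lt_of_lt_liminf (h1.trans_le hR)] with j hj
      exact EReal.coe_lt_coe_iff.1 hj
    have hl : Tendsto (fun j => (1 - (C j).maxErrProb W q) * (R - η)) atTop (𝓝 (R - η)) := by
      simpa using (herr.const_sub 1).mul_const (R - η)
    have hr : Tendsto (fun j => 1 / √(n j : ℝ) + (weightParam V δ + η) * D) atTop
        (𝓝 ((weightParam V δ + η) * D)) := by
      simpa using (hsqrt.const_div_atTop 1).add_const ((weightParam V δ + η) * D)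
    refine le_of_tendsto_of_tendsto hl hr ?_
    filter_upwards [hrate, eventually_avgWeight_div_sqrt_le hV hQne hQac hδ hn hd hlim hη,
      hsqrt.eventually_gt_atTop 0, herr.eventually_lt_const one_pos] with j h1 h2 h3 h4
    have h5 := log_numMsg_le_avgWeight (q := q) hU hac (C j)
      (ε := (C j).maxErrProb W q) fun m k =>
        (errProb_margSnd_le hq hP (C j) m k).trans (hPW ▸ errProb_le_maxErrProb (C j) _ q m k)
    calc (1 - (C j).maxErrProb W q) * (R - η)
        ≤ (1 - (C j).maxErrProb W q) * (Real.log ((C j).numMsg : ℝ) / √(n j : ℝ)) :=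
          mul_le_mul_of_nonneg_left h1.le (by linarith)
      _ = (1 - (C j).maxErrProb W q) * Real.log ((C j).numMsg : ℝ) / √(n j : ℝ) := by ring
      _ ≤ (1 + (C j).avgWeight * D) / √(n j : ℝ) := by gcongr
      _ = 1 / √(n j : ℝ) + (C j).avgWeight / √(n j : ℝ) * D := by ring
      _ ≤ 1 / √(n j : ℝ) + (weightParam V δ + η) * D := by gcongr
  have hcont : ∀ a b : ℝ, Tendsto (fun η : ℝ => a + b * η) (𝓝[>] 0) (𝓝 a) := fun a b => by
    have : Continuous fun η : ℝ => a + b * η := by fun_prop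
    simpa using (this.tendsto 0).mono_left nhdsWithin_le_nhds
  refine le_of_tendsto_of_tendsto (hcont R (-1)) (hcont (weightParam V δ * D) D) ?_
  filter_upwards [self_mem_nhdsWithin] with η h
  linarith [hη η h]

/-- Upper bound on the covert mismatch capacity. `W` is the channel to the receiver, `V` the channel
to the warden, `q` the decoding metric, `δ` the covertness parameter. The minimum of the
divergences is attained and finite, and the capacity is at most `t_δ` times it. -/
theorem theorem2 {Y Z : Type*} [Fintype Y] [Fintype Z]
    (W : Fin 2 → Y → ℝ) (V : Fin 2 → Z → ℝ) (q : Fin 2 → Y → ℝ) (δ : ℝ)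
    (hW : IsChannel W) (hV : IsChannel V)
    (hQne : V 0 ≠ V 1) (hQac : AbsCont (V 1) (V 0)) (hPac : AbsCont (W 1) (W 0))
    (hq : ∀ x y, 0 < q x y) (hδ : 0 < δ) :
    ∃ Dmin : ℝ, IsLeast (maximalDivergences W q) (Dmin : EReal) ∧
      covertMismatchCapacity W V q δ ≤ ((weightParam V δ * Dmin : ℝ) : EReal) := by
  obtain ⟨D, hD⟩ := exists_isLeast_maximalDivergences hW hPac hq
  refine ⟨D, hD, sSup_le ?_⟩
  rintro _ ⟨R, RK, rfl, hach⟩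
  obtain ⟨P, hP, hPW, hDP⟩ := hD.1
  unfold klDist at hDP
  split_ifs at hDP with hac
  · rw [EReal.coe_eq_coe_iff.1 hDP]
    exact EReal.coe_le_coe_iff.2 (hach.rate_le hV hQne hQac hq hδ hP hPW hac)
  · exact absurd hDP (EReal.coe_ne_top D)
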